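/- Let $\mathcal X,\mathcal A$ be finite sets, $N,T\ge 1$, let $p=(p_n)_{1\le n\le N}$ be transition kernels, $p_n(\cdot\mid x,a)\in\Delta_{\mathcal X}$, and let $\rho\in\Delta_{\mathcal X\times\mathcal A}$. For a policy $\pi=(\pi_n)_{1\le n\le N}$, $\pi_n(\cdot\mid x)\in\Delta_{\mathcal A}$, and a family of kernels $q=(q_n)_{1\le n\le N}$, let $Q_\pi=Q^\pi_1Q^\pi_2\cdots Q^\pi_N$ be the matrix on $\mathcal X\times\mathcal A$ with $Q^\pi_n(y,(x,a))=q_n(x\mid y)\,\pi_n(a\mid x)$; write $P_\pi$ for it when $q=p$. Assume that for some $0\le\alpha<1$, $$\|\nu P_\pi-\nu'P_\pi\|_1\le\alpha\|\nu-\nu'\|_1\quad\text{for all policies }\pi\text{ and all }\nu,\nu'\in\Delta_{\mathcal X\times\mathcal A}.$$ Agents interact with this Markov decision process during $T$ episodes of length $N$. Let $\mathcal G_t$ be the information available at the beginning of episode $t$ (the past trajectories of the restarted agent and possibly those of other agents, past losses, and internal randomness of the learner). The policy $\pi_t$ played in episode $t$ is any $\mathcal G_t$-measurable random policy; in particular the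 policies may be those computed by a mirror descent algorithm from the past data. The true initial distributions are $\rho_1=\rho$, $\rho_{t+1}=\rho_tP_{\pi_t}$. Their estimates are $\tilde\rho_1=\rho$ and $\tilde\rho_{t+1}=\tilde\rho_t\widetilde P^t_{\pi_t}$, where $\widetilde P^t_{\pi}$ is the matrix $Q_\pi$ of the empirical kernel $q=\tilde p_t$ defined as follows. In each episode $t$ one agent is reset: conditionally on $\mathcal G_t$, its trajectory $(\tilde x_{t,n},\tilde a_{t,n})_{0\le n\le N}$ starts from a pair drawn from $\tilde\rho_t$ and follows $\pi_t$ in the true dynamics $p$, and the trajectory is $\mathcal G_{t+1}$-measurable. With $$\widetilde N_{t,n}(x,a)=\sum_{s=1}^{t-1}\mathbf 1_{\{\tilde x_{s,n}=x,\ \tilde a_{s,n}=a\}},\qquad \widetilde M_{t,n}(x'\mid x,a)=\sum_{s=1}^{t-1}\mathbf 1_{\{\tilde x_{s,n+1}=x',\ \tilde x_{s,n}=x,\ \tilde a_{s,n}=a\}}$$ for $0\le n\le N-1$, put $\tilde p_{t,n+1}(x'\mid x,a)=\widetilde M_{t,n}(x'\mid x,a)/\max\{1,\widetilde N_{t,n}(x,a)\}$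 if $\widetilde N_{t,n}(x,a)\ge1$, and $\tilde p_{t,n+1}(x'\mid x,a)=1/|\mathcal X|$ otherwise. Then for every $\delta\in(0,1)$, with probability at least $1-2\delta$, $$\sum_{t=1}^T\|\rho_t-\tilde\rho_t\|_1\le\frac1{1-\alpha}\left[3N|\mathcal X|\sqrt{2|\mathcal A|T\log\frac{|\mathcal X||\mathcal A|NT}{\delta}}+2N|\mathcal X|\sqrt{2T\log\frac N\delta}\right].$$ -/

import Mathlib

open MeasureTheory

namespace PeriodicMDP

variable {X A : Type*} [Fintype X] [Fintype A] [DecidableEq X] [DecidableEq A] {N : ℕ}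

/-- The `L₁` norm of a real vector indexed by a finite type. -/
def l1norm {ι : Type*} [Fintype ι] (v : ι → ℝ) : ℝ := ∑ i, |v i|

/-- `p` is a time-dependent transition kernel over a horizon of `N` steps: `p n (x, a) x'` is the
probability to move from the pair `(x, a)` at time `n` to the state `x'` at time `n + 1`
(so `p n` is the kernel with subscript `n + 1` in one-based notation). -/
def IsKernel (p : Fin N → X × A → X → ℝ) : Prop := ∀ n y, p n y ∈ stdSimplex ℝ X

/-- `π` is a non-stationary randomised Markov policy: `π n x a` is the probability of
playing `a` in the state `x` reached at time `n + 1`. -/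
def IsPolicy (π : Fin N → X → A → ℝ) : Prop := ∀ n x, π n x ∈ stdSimplex ℝ A

/-- One-step transition matrix on state-action pairs, from time `n` to time `n + 1`:
`(y, (x, a)) ↦ p_{n+1}(x | y) π_{n+1}(a | x)`. -/
def stepMatrix (p : Fin N → X × A → X → ℝ) (π : Fin N → X → A → ℝ) (n : Fin N) :
    Matrix (X × A) (X × A) ℝ :=
  Matrix.of fun y y' => p n y y'.1 * π n y'.1 y'.2

/-- The matrix `P_π` of a whole episode, the ordered product of the `N` one-step matrices. -/
def episodeMatrix (p : Fin N → X × A → X → ℝ) (π : Fin N → X → A → ℝ) :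
    Matrix (X × A) (X × A) ℝ :=
  (List.ofFn fun n => stepMatrix p π n).prod

/-- All-policy contraction: for every policy `π` the map `ν ↦ ν P_π` contracts the `L₁` distance
of probability distributions by the factor `α`. -/
def AllPolicyContraction (p : Fin N → X × A → X → ℝ) (α : ℝ) : Prop :=
  ∀ π : Fin N → X → A → ℝ, IsPolicy π →
    ∀ ν ∈ stdSimplex ℝ (X × A), ∀ ν' ∈ stdSimplex ℝ (X × A),
      l1norm (Matrix.vecMul ν (episodeMatrix p π) - Matrix.vecMul ν' (episodeMatrix p π))
        ≤ α * l1norm (ν - ν')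

/-- The number of episodes `s < t` in which the trajectory is at the pair `y` at time `n`.
Here `τ s` is the trajectory `(y_{s,0}, …, y_{s,N})` of episode `s`; episodes are numbered
`0, 1, …, T - 1`. -/
def visitCount (τ : ℕ → Fin (N + 1) → X × A) (t : ℕ) (n : Fin N) (y : X × A) : ℕ :=
  ((Finset.range t).filter fun s => τ s n.castSucc = y).card

/-- The number of episodes `s < t` in which the trajectory moves from the pair `y` at time `n`
to the state `x'` at time `n + 1`. -/
def transitionCount (τ : ℕ → Fin (N + 1) → X × A) (t : ℕ) (n : Fin N) (y : X × A) (x' : X) : ℕ :=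
  ((Finset.range t).filter fun s => τ s n.castSucc = y ∧ (τ s n.succ).1 = x').card

/-- The empirical kernel at the beginning of episode `t`, computed from the episodes `s < t`.
The row of a pair that has not been visited yet keeps its initial value, the uniform
distribution. -/
noncomputable def empiricalKernel (τ : ℕ → Fin (N + 1) → X × A) (t : ℕ) :
    Fin N → X × A → X → ℝ :=
  fun n y x' =>
    if visitCount τ t n y = 0 then 1 / (Fintype.card X : ℝ)
    else (transitionCount τ t n y x' : ℝ) / max 1 (visitCount τ t n y : ℝ)

/-- The true initial distributions `ρ_t` without resets: `ρ_0 = ρ`, `ρ_{t+1} = ρ_t P_{π_t}`. -/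
def trueInit (p : Fin N → X × A → X → ℝ) (ρ : X × A → ℝ) (π : ℕ → Fin N → X → A → ℝ) :
    ℕ → X × A → ℝ
  | 0 => ρ
  | t + 1 => Matrix.vecMul (trueInit p ρ π t) (episodeMatrix p (π t))

/-- The estimated initial distributions: the first one is `ρ`, and the one of episode `t + 1` is
the one of episode `t` times the episode matrix of `π_t` under the empirical kernel of
episode `t`. -/
noncomputable def estInit (ρ : X × A → ℝ) (π : ℕ → Fin N → X → A → ℝ)
    (τ : ℕ → Fin (N + 1) → X × A) : ℕ → X × A → ℝ
  | 0 => ρ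
  | t + 1 => Matrix.vecMul (estInit ρ π τ t) (episodeMatrix (empiricalKernel τ t) (π t))

/-- The interaction protocol over `T` episodes. The σ-algebra `𝓖 t` is the information available
at the beginning of episode `t` (past trajectories of the restarted agent and of all other agents,
past losses, internal randomness of the learner). The policy `π t` played in episode `t` is chosen
from this information; the restarted agent is then reset to a pair drawn from the estimated
distribution of episode `t` and follows `π t` in the true dynamics `p`, and its trajectory
`τ t = (y_{t,0}, …, y_{t,N})` belongs to the information available at the next episode. -/
structure IsRestartProtocol {Ω : Type*} {mΩ : MeasurableSpace Ω} (ℙ : Measure Ω)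
    (𝓖 : Filtration ℕ mΩ) (T : ℕ) (p : Fin N → X × A → X → ℝ) (ρ : X × A → ℝ)
    (π : ℕ → Ω → Fin N → X → A → ℝ) (τ : ℕ → Ω → Fin (N + 1) → X × A) : Prop where
  isPolicy : ∀ t < T, ∀ ω, IsPolicy (π t ω)
  measurable_policy : ∀ t < T, ∀ n x a, Measurable[𝓖 t] fun ω => π t ω n x a
  measurable_trajectory : ∀ t < T, ∀ y, MeasurableSet[𝓖 (t + 1)] {ω | τ t ω = y}
  law_trajectory : ∀ t < T, ∀ y : Fin (N + 1) → X × A,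
    ℙ[Set.indicator {ω | τ t ω = y} (fun _ => (1 : ℝ)) | 𝓖 t] =ᵐ[ℙ] fun ω =>
      estInit ρ (fun s => π s ω) (fun s => τ s ω) t (y 0) *
        ∏ n : Fin N, stepMatrix p (π t ω) n (y n.castSucc) (y n.succ)

end PeriodicMDP

/-!
By the contraction, `∑ ‖ρ_t - ρ̃_t‖₁` is at most `(1 - α)⁻¹` times the sum over `t` of the
one-episode errors `‖ρ̃_t P_{π_t} - ρ̃_t P̃_{π_t}‖₁`. Replacing the true kernel by the empirical one
step by step bounds such an error by the conditional expectation, given the past, of the `L₁` errors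
of the empirical rows that the restarted trajectory of the same episode visits; the restart from
`ρ̃_t` is what makes the two laws agree. By Azuma's inequality the conditional expectations may be
replaced by the observed errors. The latter are controlled by a row-wise `L₁` concentration
inequality, in which the random number of visits is handled by stopping an exponential
supermartingale after the `m`-th visit, and by summing `1 / √k` over the successive visits of every
pair.
-/

namespace PeriodicMDP

open scoped Matrix

section L1Norm

variable {ι : Type*} [Fintype ι]

lemma l1norm_nonneg (v : ι → ℝ) : 0 ≤ l1norm v := Finset.sum_nonneg fun _ _ => abs_nonneg _

@[simp]
lemma l1norm_zero : l1norm (0 : ι → ℝ) = 0 := by simp [l1norm]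

lemma l1norm_add_le (v w : ι → ℝ) : l1norm (v + w) ≤ l1norm v + l1norm w := by
  simp only [l1norm, ← Finset.sum_add_distrib]
  exact Finset.sum_le_sum fun i _ => abs_add_le _ _

lemma l1norm_sub_le (v w : ι → ℝ) : l1norm (v - w) ≤ l1norm v + l1norm w := by
  simp only [l1norm, ← Finset.sum_add_distrib]
  exact Finset.sum_le_sum fun i _ => abs_sub _ _

lemma l1norm_eq_one {v : ι → ℝ} (hv : v ∈ stdSimplex ℝ ι) : l1norm v = 1 := by
  rw [← hv.2]
  exact Finset.sum_congr rfl fun i _ => abs_of_nonneg (hv.1 i)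

lemma l1norm_sub_le_two {v w : ι → ℝ} (hv : v ∈ stdSimplex ℝ ι) (hw : w ∈ stdSimplex ℝ ι) :
    l1norm (v - w) ≤ 2 := by
  linarith [l1norm_sub_le v w, l1norm_eq_one hv, l1norm_eq_one hw]

lemma exists_finset_l1norm_eq_sum_sign [DecidableEq ι] (v : ι → ℝ) :
    ∃ S : Finset ι, l1norm v = ∑ i, v i * if i ∈ S then 1 else -1 := by
  refine ⟨Finset.univ.filter fun i => 0 ≤ v i, Finset.sum_congr rfl fun i _ => ?_⟩
  rcases le_or_gt 0 (v i) with h | h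
  · simp [h, abs_of_nonneg]
  · simp [h.not_ge, abs_of_neg h]

lemma l1norm_vecMul_le (v : ι → ℝ) (M : Matrix ι ι ℝ) :
    l1norm (v ᵥ* M) ≤ ∑ i, |v i| * l1norm (M i) := by
  simp only [l1norm, Matrix.vecMul, dotProduct, Finset.mul_sum]
  rw [Finset.sum_comm]
  refine Finset.sum_le_sum fun j _ => (Finset.abs_sum_le_sum_abs _ _).trans_eq ?_
  exact Finset.sum_congr rfl fun i _ => abs_mul _ _

end L1Norm

section RowStochastic

variable {Y : Type*} [Fintype Y] [DecidableEq Y] {M : Matrix Y Y ℝ}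

lemma mem_rowStochastic_iff_forall_mem_stdSimplex :
    M ∈ Matrix.rowStochastic ℝ Y ↔ ∀ a, M a ∈ stdSimplex ℝ Y :=
  Matrix.mem_rowStochastic_iff_sum.trans forall_and.symm

lemma sum_vecMul_of_mem_rowStochastic (hM : M ∈ Matrix.rowStochastic ℝ Y) (ν : Y → ℝ) :
    ∑ b, (ν ᵥ* M) b = ∑ a, ν a := by
  rw [← dotProduct_one, ← Matrix.dotProduct_mulVec, Matrix.one_vecMul_of_mem_rowStochastic hM,
    dotProduct_one]

lemma vecMul_mem_stdSimplex {ν : Y → ℝ} (hν : ν ∈ stdSimplex ℝ Y)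
    (hM : M ∈ Matrix.rowStochastic ℝ Y) : ν ᵥ* M ∈ stdSimplex ℝ Y :=
  ⟨Matrix.nonneg_vecMul_of_mem_rowStochastic hM hν.1,
    (sum_vecMul_of_mem_rowStochastic hM ν).trans hν.2⟩

lemma l1norm_vecMul_le_of_mem_rowStochastic (hM : M ∈ Matrix.rowStochastic ℝ Y) (v : Y → ℝ) :
    l1norm (v ᵥ* M) ≤ l1norm v := by
  refine (l1norm_vecMul_le v M).trans_eq (Finset.sum_congr rfl fun a _ => ?_)
  rw [l1norm_eq_one (mem_rowStochastic_iff_forall_mem_stdSimplex.1 hM a), mul_one]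

lemma prod_ofFn_mem_rowStochastic {N : ℕ} {K : Fin N → Matrix Y Y ℝ}
    (hK : ∀ n, K n ∈ Matrix.rowStochastic ℝ Y) :
    (List.ofFn K).prod ∈ Matrix.rowStochastic ℝ Y :=
  Submonoid.list_prod_mem _ (List.forall_mem_ofFn_iff.2 hK)

end RowStochastic

section PathWeight

variable {Y : Type*} {N : ℕ}

/-- The weight of a path of the inhomogeneous Markov chain with initial vector `ν` and transition
matrices `K`, so that the law of the chain is a finite sum over paths. The vector `ν` need not be
normalised, which allows the first step to be absorbed into it. -/
def pathWeight (ν : Y → ℝ) (K : Fin N → Matrix Y Y ℝ) (y : Fin (N + 1) → Y) : ℝ :=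
  ν (y 0) * ∏ n, K n (y n.castSucc) (y n.succ)

lemma pathWeight_nonneg {ν : Y → ℝ} {K : Fin N → Matrix Y Y ℝ} (hν : ∀ a, 0 ≤ ν a)
    (hK : ∀ n a b, 0 ≤ K n a b) (y : Fin (N + 1) → Y) : 0 ≤ pathWeight ν K y :=
  mul_nonneg (hν _) (Finset.prod_nonneg fun n _ => hK n _ _)

lemma pathWeight_cons (ν : Y → ℝ) (K : Fin (N + 1) → Matrix Y Y ℝ) (a : Y)
    (y : Fin (N + 1) → Y) :
    pathWeight ν K (Fin.cons a y : Fin (N + 2) → Y) =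
      pathWeight (fun b => ν a * K 0 a b) (fun n => K n.succ) y := by
  simp [pathWeight, Fin.prod_univ_succ, mul_assoc, Fin.castSucc_succ]

variable [Fintype Y]

lemma sum_path_succ (f : (Fin (N + 2) → Y) → ℝ) :
    ∑ y, f y = ∑ a, ∑ y : Fin (N + 1) → Y, f (Fin.cons a y) := by
  rw [← (Fin.consEquiv fun _ : Fin (N + 2) => Y).sum_comp, Fintype.sum_prod_type]
  rfl

lemma sum_pathWeight_mul_tail (ν : Y → ℝ) (K : Fin (N + 1) → Matrix Y Y ℝ)
    (φ : (Fin (N + 1) → Y) → ℝ) :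
    ∑ y, pathWeight ν K y * φ (fun n => y n.succ) =
      ∑ y, pathWeight (ν ᵥ* K 0) (fun n => K n.succ) y * φ y := by
  rw [sum_path_succ, Finset.sum_comm]
  refine Finset.sum_congr rfl fun y _ => ?_
  simp_rw [pathWeight_cons]
  simp only [Fin.cons_succ, pathWeight, Matrix.vecMul, dotProduct, Finset.sum_mul]

variable [DecidableEq Y]

lemma sum_pathWeight (ν : Y → ℝ) {K : Fin N → Matrix Y Y ℝ}
    (hK : ∀ n, K n ∈ Matrix.rowStochastic ℝ Y) : ∑ y, pathWeight ν K y = ∑ a, ν a := by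
  induction N generalizing ν with
  | zero =>
    rw [← (Equiv.funUnique (Fin 1) Y).symm.sum_comp]
    simp [pathWeight]
  | succ N ih =>
    have htail := sum_pathWeight_mul_tail ν K fun _ => 1
    simp only [mul_one] at htail
    rw [htail, ih _ fun n => hK n.succ, sum_vecMul_of_mem_rowStochastic (hK 0)]

lemma sum_pathWeight_mul_zero_one (ν : Y → ℝ) {K : Fin (N + 1) → Matrix Y Y ℝ}
    (hK : ∀ n, K n ∈ Matrix.rowStochastic ℝ Y) (φ : Y → Y → ℝ) :
    ∑ y, pathWeight ν K y * φ (y 0) (y 1) = ∑ a, ν a * ∑ b, K 0 a b * φ a b := by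
  rw [sum_path_succ]
  refine Finset.sum_congr rfl fun a _ => ?_
  have hcons : ∀ y : Fin (N + 1) → Y,
      pathWeight ν K (Fin.cons a y : Fin (N + 2) → Y) * φ a (y 0) =
        pathWeight (fun b => ν a * (K 0 a b * φ a b)) (fun n => K n.succ) y := fun y => by
    rw [pathWeight_cons, pathWeight, pathWeight]
    ring
  refine (Finset.sum_congr rfl fun y _ => hcons y).trans ?_
  rw [sum_pathWeight _ fun n => hK n.succ, Finset.mul_sum]

lemma sum_pathWeight_mul_castSucc_succ_le {ν : Y → ℝ} {K : Fin N → Matrix Y Y ℝ}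
    (hν : ν ∈ stdSimplex ℝ Y) (hK : ∀ n, K n ∈ Matrix.rowStochastic ℝ Y) (m : Fin N)
    {φ : Y → Y → ℝ} {c : ℝ} (hφ : ∀ a, ∑ b, K m a b * φ a b ≤ c) :
    ∑ y, pathWeight ν K y * φ (y m.castSucc) (y m.succ) ≤ c := by
  induction N generalizing ν with
  | zero => exact m.elim0
  | succ N ih =>
    induction m using Fin.cases with
    | zero =>
      calc ∑ y, pathWeight ν K y * φ (y 0) (y 1)
          = ∑ a, ν a * ∑ b, K 0 a b * φ a b := sum_pathWeight_mul_zero_one ν hK φ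
        _ ≤ ∑ a, ν a * c :=
            Finset.sum_le_sum fun a _ => mul_le_mul_of_nonneg_left (hφ a) (hν.1 a)
        _ = c := by rw [← Finset.sum_mul, hν.2, one_mul]
    | succ m =>
      refine (sum_pathWeight_mul_tail ν K fun y => φ (y m.castSucc) (y m.succ)).trans_le ?_
      exact ih (vecMul_mem_stdSimplex hν (hK 0)) (fun n => hK n.succ) m hφ

lemma l1norm_vecMul_vecMul_sub_le {ν : Y → ℝ} (hν : ∀ a, 0 ≤ ν a) (M M' : Matrix Y Y ℝ)
    {P P' : Matrix Y Y ℝ} (hP' : P' ∈ Matrix.rowStochastic ℝ Y) :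
    l1norm (ν ᵥ* M ᵥ* P - ν ᵥ* M' ᵥ* P') ≤
      ∑ a, ν a * l1norm (M a - M' a) + l1norm (ν ᵥ* M ᵥ* P - ν ᵥ* M ᵥ* P') := by
  have hsplit : ν ᵥ* M ᵥ* P - ν ᵥ* M' ᵥ* P' =
      ν ᵥ* (M - M') ᵥ* P' + (ν ᵥ* M ᵥ* P - ν ᵥ* M ᵥ* P') := by
    rw [Matrix.vecMul_sub, Matrix.sub_vecMul]
    abel
  rw [hsplit]
  refine (l1norm_add_le _ _).trans (add_le_add_left ?_ _)
  calc l1norm (ν ᵥ* (M - M') ᵥ* P') ≤ l1norm (ν ᵥ* (M - M')) :=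
        l1norm_vecMul_le_of_mem_rowStochastic hP' _
    _ ≤ ∑ a, |ν a| * l1norm (M a - M' a) := l1norm_vecMul_le _ _
    _ = ∑ a, ν a * l1norm (M a - M' a) := by simp only [abs_of_nonneg (hν _)]

/-- By telescoping: when one step is exchanged, the later steps do not increase the `L₁` norm, so
only the rows visited under the first chain matter. -/
lemma l1norm_vecMul_prod_sub_le {ν : Y → ℝ} {K K' : Fin N → Matrix Y Y ℝ} (hν : ∀ a, 0 ≤ ν a)
    (hK : ∀ n, K n ∈ Matrix.rowStochastic ℝ Y) (hK' : ∀ n, K' n ∈ Matrix.rowStochastic ℝ Y) :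
    l1norm (ν ᵥ* (List.ofFn K).prod - ν ᵥ* (List.ofFn K').prod) ≤
      ∑ n, ∑ y, pathWeight ν K y * l1norm (K n (y n.castSucc) - K' n (y n.castSucc)) := by
  induction N generalizing ν with
  | zero => simp
  | succ N ih =>
    simp only [List.ofFn_succ, List.prod_cons, ← Matrix.vecMul_vecMul]
    rw [Fin.sum_univ_succ]
    refine (l1norm_vecMul_vecMul_sub_le hν (K 0) (K' 0)
      (prod_ofFn_mem_rowStochastic fun n => hK' n.succ)).trans (add_le_add (le_of_eq ?_) ?_)
    · refine .trans ?_ (sum_pathWeight_mul_zero_one ν hK fun a _ => l1norm (K 0 a - K' 0 a)).symm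
      simp only [← Finset.sum_mul, Matrix.sum_row_of_mem_rowStochastic (hK 0), one_mul]
    · refine (ih (Matrix.nonneg_vecMul_of_mem_rowStochastic (hK 0) hν) (fun n => hK n.succ)
        fun n => hK' n.succ).trans_eq (Finset.sum_congr rfl fun n _ => ?_)
      exact (sum_pathWeight_mul_tail ν K fun y =>
        l1norm (K n.succ (y n.castSucc) - K' n.succ (y n.castSucc))).symm

end PathWeight

section Concentration

lemma sum_mul_exp_sub_le_one {ι : Type*} [Fintype ι] {w f : ι → ℝ} {a b : ℝ}
    (hw : w ∈ stdSimplex ℝ ι) (hf : ∀ i, f i ∈ Set.Icc a b) (l : ℝ) :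
    ∑ i, w i * Real.exp (l * (f i - ∑ j, w j * f j) - l ^ 2 * (b - a) ^ 2 / 8) ≤ 1 := by
  let _ : MeasurableSpace ι := ⊤
  let P : PMF ι := PMF.ofFintype (fun i => ENNReal.ofReal (w i)) (by
    rw [← ENNReal.ofReal_sum_of_nonneg fun i _ => hw.1 i, hw.2, ENNReal.ofReal_one])
  have hint : ∀ F : ι → ℝ, ∫ i, F i ∂P.toMeasure = ∑ i, w i * F i := fun F => by
    simp [P, PMF.integral_eq_sum, ENNReal.toReal_ofReal (hw.1 _)]
  have hmgf := (ProbabilityTheory.hasSubgaussianMGF_of_mem_Icc (μ := P.toMeasure)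
    (measurable_of_finite f).aemeasurable (Filter.Eventually.of_forall hf)).mgf_le l
  rw [ProbabilityTheory.mgf, hint, hint] at hmgf
  have hvar : ((‖b - a‖₊ / 2) ^ 2 : NNReal) * l ^ 2 / 2 = l ^ 2 * (b - a) ^ 2 / 8 := by
    push_cast
    rw [Real.norm_eq_abs, div_pow, sq_abs]
    ring
  simp only [Real.exp_sub, ← mul_div_assoc, ← Finset.sum_div]
  exact div_le_one_of_le₀ (hvar ▸ hmgf) (Real.exp_pos _).le

variable {Ω Y : Type*} {mΩ : MeasurableSpace Ω}

/-- For `t < T`, the random variable `τ t` is known at time `t + 1` and has the conditional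
law `w t` given the information at time `t`. As `Y` is finite, the law is a vector of
weights rather than a conditional kernel. -/
structure HasCondLaw (ℙ : Measure Ω) (𝓖 : Filtration ℕ mΩ) (T : ℕ) (τ : ℕ → Ω → Y)
    (w : ℕ → Ω → Y → ℝ) : Prop where
  measurableSet : ∀ t < T, ∀ y, MeasurableSet[𝓖 (t + 1)] {ω | τ t ω = y}
  condExp_indicator : ∀ t < T, ∀ y,
    ℙ[Set.indicator {ω | τ t ω = y} (fun _ => (1 : ℝ)) | 𝓖 t] =ᵐ[ℙ] fun ω => w t ω y

namespace HasCondLaw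

variable {ℙ : Measure Ω} {𝓖 : Filtration ℕ mΩ} {T : ℕ} {τ : ℕ → Ω → Y} {w : ℕ → Ω → Y → ℝ}
  {g : ℕ → Y → Ω → ℝ} {t : ℕ}

lemma measurable_comp [Finite Y] (h : HasCondLaw ℙ 𝓖 T τ w) (ht : t < T) {g : Y → Ω → ℝ}
    (hg : ∀ y, Measurable[𝓖 (t + 1)] (g y)) : Measurable[𝓖 (t + 1)] fun ω => g (τ t ω) ω := by
  classical
  have := Fintype.ofFinite Y
  have hsum : (fun ω => g (τ t ω) ω) = fun ω => ∑ y, if τ t ω = y then g y ω else 0 := by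
    simp
  rw [hsum]
  exact Finset.measurable_sum _ fun y _ =>
    Measurable.ite (h.measurableSet t ht y) (hg y) measurable_const

lemma measurable_sum_comp [Finite Y] (h : HasCondLaw ℙ 𝓖 T τ w)
    (hg : ∀ t < T, ∀ y, Measurable[𝓖 t] (g t y)) (ht : t ≤ T) :
    Measurable[𝓖 t] fun ω => ∑ s ∈ Finset.range t, g s (τ s ω) ω := by
  refine Finset.measurable_sum _ fun s hs => ?_
  have hst : s < t := Finset.mem_range.1 hs
  exact (h.measurable_comp (hst.trans_le ht) fun y =>
    (hg s (hst.trans_le ht) y).mono (𝓖.mono s.le_succ) le_rfl).mono (𝓖.mono hst) le_rfl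

variable [IsProbabilityMeasure ℙ]

lemma integrable_exp_sum [Finite Y] (h : HasCondLaw ℙ 𝓖 T τ w)
    (hg : ∀ t < T, ∀ y, Measurable[𝓖 t] (g t y)) {C : ℝ} (hC : ∀ t < T, ∀ y ω, g t y ω ≤ C)
    (ht : t ≤ T) :
    Integrable (fun ω => Real.exp (∑ s ∈ Finset.range t, g s (τ s ω) ω)) ℙ := by
  refine .of_bound
    (((h.measurable_sum_comp hg ht).exp.mono (𝓖.le t) le_rfl).aestronglyMeasurable)
    (Real.exp (t * C)) (.of_forall fun ω => ?_)
  rw [Real.norm_eq_abs, Real.abs_exp, Real.exp_le_exp]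
  simpa using Finset.sum_le_card_nsmul (Finset.range t) (fun s => g s (τ s ω) ω) C
    fun s hs => hC s ((Finset.mem_range.1 hs).trans_le ht) _ _

variable [Fintype Y]

lemma condExp_comp (h : HasCondLaw ℙ 𝓖 T τ w) (ht : t < T) {g : Y → Ω → ℝ}
    (hg : ∀ y, Measurable[𝓖 t] (g y)) {C : ℝ} (hC : ∀ y ω, |g y ω| ≤ C) :
    ℙ[fun ω => g (τ t ω) ω | 𝓖 t] =ᵐ[ℙ] fun ω => ∑ y, w t ω y * g y ω := by
  classical
  set I : Y → Ω → ℝ := fun y => Set.indicator {ω | τ t ω = y} fun _ => 1 with hI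
  have hIint : ∀ y, Integrable (I y) ℙ := fun y =>
    (integrable_const (1 : ℝ)).indicator (𝓖.le _ _ (h.measurableSet t ht y))
  have hsum : (fun ω => g (τ t ω) ω) = ∑ y, g y * I y := by
    funext ω
    simp [hI, Set.indicator_apply]
  rw [hsum]
  refine (condExp_finsetSum (fun y _ => (hIint y).bdd_mul
    ((hg y).mono (𝓖.le t) le_rfl).aestronglyMeasurable (.of_forall (hC y))) _).trans ?_
  have hpull : ∀ y, ℙ[g y * I y | 𝓖 t] =ᵐ[ℙ] g y * ℙ[I y | 𝓖 t] := fun y =>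
    condExp_stronglyMeasurable_mul_of_bound (𝓖.le t) (hg y).stronglyMeasurable (hIint y) C
      (.of_forall (hC y))
  filter_upwards [ae_all_iff.2 hpull, ae_all_iff.2 (h.condExp_indicator t ht)] with ω hω hw
  rw [Finset.sum_apply]
  exact Finset.sum_congr rfl fun y _ =>
    (hω y).trans (by rw [Pi.mul_apply, hw y, mul_comm])

lemma integral_exp_sum_le_one (h : HasCondLaw ℙ 𝓖 T τ w)
    (hg : ∀ t < T, ∀ y, Measurable[𝓖 t] (g t y)) {C : ℝ} (hC : ∀ t < T, ∀ y ω, g t y ω ≤ C)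
    (hg1 : ∀ t < T, ∀ ω, ∑ y, w t ω y * Real.exp (g t y ω) ≤ 1) (ht : t ≤ T) :
    ∫ ω, Real.exp (∑ s ∈ Finset.range t, g s (τ s ω) ω) ∂ℙ ≤ 1 := by
  induction t with
  | zero => simp
  | succ t ih =>
    set E : Ω → ℝ := fun ω => Real.exp (∑ s ∈ Finset.range t, g s (τ s ω) ω) with hE
    have hEle : ∀ ω, E ω ≤ Real.exp (t * C) := fun ω => by
      rw [hE, Real.exp_le_exp]
      simpa using Finset.sum_le_card_nsmul (Finset.range t) (fun s => g s (τ s ω) ω) C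
        fun s hs => hC s ((Finset.mem_range.1 hs).trans ht) _ _
    have hcond := h.condExp_comp ht (g := fun y ω => E ω * Real.exp (g t y ω))
      (fun y => (h.measurable_sum_comp hg (Nat.le_of_succ_le ht)).exp.mul (hg t ht y).exp)
      (C := Real.exp (t * C) * Real.exp C) fun y ω => by
        rw [abs_of_nonneg (by positivity)]
        exact mul_le_mul (hEle ω) (Real.exp_le_exp.2 (hC t ht y ω)) (Real.exp_pos _).le
          (Real.exp_pos _).le
    simp only [Finset.sum_range_succ, Real.exp_add]
    rw [← integral_condExp (𝓖.le t)]
    refine (integral_mono_ae integrable_condExp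
      (h.integrable_exp_sum hg hC (Nat.le_of_succ_le ht)) ?_).trans (ih (Nat.le_of_succ_le ht))
    filter_upwards [hcond] with ω hω
    calc _ = E ω * ∑ y, w t ω y * Real.exp (g t y ω) := by
          rw [hω, Finset.mul_sum]
          exact Finset.sum_congr rfl fun y _ => mul_left_comm _ _ _
      _ ≤ E ω := mul_le_of_le_one_right (Real.exp_pos _).le (hg1 t ht ω)

lemma measureReal_le_sum_le_exp_neg (h : HasCondLaw ℙ 𝓖 T τ w)
    (hg : ∀ t < T, ∀ y, Measurable[𝓖 t] (g t y)) {C : ℝ} (hC : ∀ t < T, ∀ y ω, g t y ω ≤ C)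
    (hg1 : ∀ t < T, ∀ ω, ∑ y, w t ω y * Real.exp (g t y ω) ≤ 1) (u : ℝ) :
    ℙ.real {ω | u ≤ ∑ t ∈ Finset.range T, g t (τ t ω) ω} ≤ Real.exp (-u) := by
  have hchernoff := ProbabilityTheory.measure_ge_le_exp_mul_mgf (μ := ℙ)
    (X := fun ω => ∑ t ∈ Finset.range T, g t (τ t ω) ω) (t := 1) u zero_le_one
    (by simpa only [one_mul] using h.integrable_exp_sum hg hC le_rfl)
  simp only [ProbabilityTheory.mgf, one_mul, neg_mul] at hchernoff
  exact hchernoff.trans (mul_le_of_le_one_right (Real.exp_pos _).le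
    (h.integral_exp_sum_le_one hg hC hg1 le_rfl))

lemma measureReal_le_sum_mean_sub_le (h : HasCondLaw ℙ 𝓖 T τ w)
    (hw : ∀ t < T, ∀ ω, w t ω ∈ stdSimplex ℝ Y)
    (hwm : ∀ t < T, ∀ y, Measurable[𝓖 t] fun ω => w t ω y) {D : ℕ → Y → Ω → ℝ}
    (hDm : ∀ t < T, ∀ y, Measurable[𝓖 t] (D t y)) {a b : ℝ}
    (hD : ∀ t < T, ∀ y ω, D t y ω ∈ Set.Icc a b) {ε : ℝ} (hε : 0 ≤ ε) :
    ℙ.real {ω | ε ≤ ∑ t ∈ Finset.range T, ((∑ y, w t ω y * D t y ω) - D t (τ t ω) ω)} ≤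
      Real.exp (-(2 * ε ^ 2 / (T * (b - a) ^ 2))) := by
  set V : ℝ := T * (b - a) ^ 2
  set l : ℝ := 4 * ε / V with hl
  have hl0 : 0 ≤ l := by positivity
  have hmean : ∀ t < T, ∀ ω, ∑ y, w t ω y * D t y ω ≤ b := fun t ht ω => by
    calc ∑ y, w t ω y * D t y ω ≤ ∑ y, w t ω y * b := Finset.sum_le_sum fun y _ =>
          mul_le_mul_of_nonneg_left (hD t ht y ω).2 ((hw t ht ω).1 y)
      _ = b := by rw [← Finset.sum_mul, (hw t ht ω).2, one_mul]
  have htail := h.measureReal_le_sum_le_exp_neg (C := l * (b - a))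
    (g := fun t y ω => -l * (D t y ω - ∑ z, w t ω z * D t z ω) - (-l) ^ 2 * (b - a) ^ 2 / 8)
    (fun t ht y => (((hDm t ht y).sub (Finset.measurable_sum _ fun z _ =>
      (hwm t ht z).mul (hDm t ht z))).const_mul _).sub_const _)
    (fun t ht y ω => by
      have := mul_le_mul_of_nonneg_left (sub_le_sub (hmean t ht ω) (hD t ht y ω).1) hl0
      have : 0 ≤ (-l) ^ 2 * (b - a) ^ 2 / 8 := by positivity
      linarith)
    (fun t ht ω => sum_mul_exp_sub_le_one (hw t ht ω) (fun y => hD t ht y ω) (-l))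
    (2 * ε ^ 2 / V)
  refine (measureReal_mono fun ω hω => ?_).trans htail
  have hopt : 2 * ε ^ 2 / V = l * ε - V * l ^ 2 / 8 := by
    rcases eq_or_ne V 0 with hV0 | hV0
    · simp [hl, hV0]
    · rw [hl]
      field_simp
      ring
  have hmul := mul_le_mul_of_nonneg_left (Set.mem_ofPred_eq ▸ hω) hl0
  simp only [Set.mem_ofPred_eq, Finset.sum_sub_distrib, ← Finset.mul_sum, Finset.sum_const,
    Finset.card_range, nsmul_eq_mul] at hmul ⊢
  linarith

end HasCondLaw

lemma one_sub_le_measureReal_of_compl_subset {Ω : Type*} {mΩ : MeasurableSpace Ω} {ℙ : Measure Ω}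
    [IsProbabilityMeasure ℙ] {G B₁ B₂ : Set Ω} (h : Gᶜ ⊆ B₁ ∪ B₂) :
    1 - (ℙ.real B₁ + ℙ.real B₂) ≤ ℙ.real G := by
  have hcover := measureReal_union_le (μ := ℙ) G Gᶜ
  rw [Set.union_compl_self, probReal_univ] at hcover
  linarith [measureReal_mono (μ := ℙ) h, measureReal_union_le (μ := ℙ) B₁ B₂]

end Concentration

section Counts

lemma sum_sqrt_le_sqrt_card_mul_sum {ι : Type*} [Fintype ι] {f : ι → ℝ} (hf : ∀ i, 0 ≤ f i) :
    ∑ i, √(f i) ≤ √(Fintype.card ι * ∑ i, f i) := by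
  refine Real.le_sqrt_of_sq_le ?_
  simpa only [Real.sq_sqrt (hf _), Finset.card_univ] using
    sq_sum_le_card_mul_sum_sq (s := Finset.univ) (f := fun i => √(f i))

lemma one_le_three_mul_sqrt_add_one_sub_sqrt_mul_sqrt {x : ℝ} (hx : 1 ≤ x) :
    1 ≤ 3 * (√(x + 1) - √x) * √x := by
  have hsq := Real.sq_sqrt (show 0 ≤ x by linarith)
  have hsq' := Real.sq_sqrt (show 0 ≤ x + 1 by linarith)
  have hmono : √x ≤ √(x + 1) := Real.sqrt_le_sqrt (by linarith)
  have hle : √(x + 1) ≤ 2 * √x := Real.sqrt_le_iff.2 ⟨by positivity, by rw [mul_pow, hsq]; linarith⟩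
  nlinarith [mul_nonneg (sub_nonneg.2 hmono) (sub_nonneg.2 hle)]

lemma sum_range_le_three_mul_sqrt {e : ℕ → ℝ} {c : ℝ} (hc : 0 ≤ c) (h0 : e 0 ≤ 3 * c)
    (he : ∀ k : ℕ, √(k : ℝ) * e k ≤ c) (m : ℕ) : ∑ k ∈ Finset.range m, e k ≤ 3 * c * √(m : ℝ) := by
  induction m with
  | zero => simp
  | succ m ih =>
    suffices e m ≤ 3 * c * (√((m : ℝ) + 1) - √(m : ℝ)) by
      rw [Finset.sum_range_succ, Nat.cast_succ]
      linarith
    rcases m.eq_zero_or_pos with rfl | hm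
    · simpa using h0
    · have hm1 : (1 : ℝ) ≤ m := Nat.one_le_cast.2 hm
      refine le_of_mul_le_mul_left ((he m).trans ?_) (Real.sqrt_pos.2 (zero_lt_one.trans_le hm1))
      calc c ≤ c * (3 * (√((m : ℝ) + 1) - √(m : ℝ)) * √(m : ℝ)) :=
            le_mul_of_one_le_right hc (one_le_three_mul_sqrt_add_one_sub_sqrt_mul_sqrt hm1)
        _ = √(m : ℝ) * (3 * c * (√((m : ℝ) + 1) - √(m : ℝ))) := by ring

variable {Y : Type*} [Fintype Y] [DecidableEq Y]

lemma sum_comp_count {M : Type*} [AddCommMonoid M] (z : ℕ → Y) (f : ℕ → M) (T : ℕ) :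
    ∑ t ∈ Finset.range T, f (Nat.count (z · = z t) t) =
      ∑ y, ∑ k ∈ Finset.range (Nat.count (z · = y) T), f k := by
  induction T with
  | zero => simp
  | succ T ih =>
    have hsucc : ∀ y, ∑ k ∈ Finset.range (Nat.count (z · = y) (T + 1)), f k =
        ∑ k ∈ Finset.range (Nat.count (z · = y) T), f k +
          if z T = y then f (Nat.count (z · = y) T) else 0 := fun y => by
      rw [Nat.count_succ]
      split_ifs
      · rw [Finset.sum_range_succ]
      · simp
    simp only [hsucc, Finset.sum_add_distrib, Finset.sum_range_succ, ih, Finset.sum_ite_eq,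
      Finset.mem_univ, if_true]

lemma sum_count_eq (z : ℕ → Y) (T : ℕ) : ∑ y, Nat.count (z · = y) T = T := by
  simpa using (sum_comp_count z (fun _ => (1 : ℕ)) T).symm

lemma sum_comp_count_le {e : ℕ → ℝ} {c : ℝ} (hc : 0 ≤ c) (h0 : e 0 ≤ 3 * c)
    (he : ∀ k : ℕ, √(k : ℝ) * e k ≤ c) (z : ℕ → Y) (T : ℕ) :
    ∑ t ∈ Finset.range T, e (Nat.count (z · = z t) t) ≤ 3 * c * √(Fintype.card Y * T : ℝ) := by
  calc ∑ t ∈ Finset.range T, e (Nat.count (z · = z t) t)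
      = ∑ y, ∑ k ∈ Finset.range (Nat.count (z · = y) T), e k := sum_comp_count z e T
    _ ≤ ∑ y, 3 * c * √(Nat.count (z · = y) T : ℝ) :=
        Finset.sum_le_sum fun y _ => sum_range_le_three_mul_sqrt hc h0 he _
    _ ≤ 3 * c * √(Fintype.card Y * ∑ y, (Nat.count (z · = y) T : ℝ)) := by
        rw [← Finset.mul_sum]
        exact mul_le_mul_of_nonneg_left (sum_sqrt_le_sqrt_card_mul_sum fun y => Nat.cast_nonneg _)
          (by positivity)
    _ = 3 * c * √(Fintype.card Y * T : ℝ) := by rw [← Nat.cast_sum, sum_count_eq]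

lemma sum_range_ite_count_lt_and {M : Type*} [AddCommMonoid M] (P : ℕ → Prop) [DecidablePred P]
    {t T : ℕ} (ht : t ≤ T) (F : ℕ → M) :
    ∑ s ∈ Finset.range T, (if Nat.count P s < Nat.count P t ∧ P s then F s else 0) =
      ∑ s ∈ Finset.range t, if P s then F s else 0 := by
  have hstopped : ∀ s ∈ Finset.Ico t T,
      (if Nat.count P s < Nat.count P t ∧ P s then F s else 0) = 0 := fun s hs =>
    if_neg fun hlt => (Nat.count_monotone P (Finset.mem_Ico.1 hs).1).not_gt hlt.1
  rw [← Finset.sum_range_add_sum_Ico _ ht, Finset.sum_eq_zero hstopped, add_zero]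
  refine Finset.sum_congr rfl fun s hs => if_congr (and_iff_right_of_imp fun hPs => ?_) rfl rfl
  exact Nat.count_strict_mono hPs (Finset.mem_range.1 hs)

end Counts

section Kernels

variable {X A : Type*} {N : ℕ} {p : Fin N → X × A → X → ℝ} {π : Fin N → X → A → ℝ}

lemma sum_stepMatrix_mul_fst [Fintype X] [Fintype A] (p : Fin N → X × A → X → ℝ)
    (hπ : IsPolicy π) (n : Fin N) (y : X × A) (F : X → ℝ) :
    ∑ z, stepMatrix p π n y z * F z.1 = ∑ x, p n y x * F x := by
  simp only [Fintype.sum_prod_type, stepMatrix, Matrix.of_apply, ← Finset.sum_mul,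
    ← Finset.mul_sum, (hπ n _).2, mul_one]

lemma l1norm_stepMatrix_sub [Fintype X] [Fintype A] (p q : Fin N → X × A → X → ℝ)
    (hπ : IsPolicy π) (n : Fin N) (y : X × A) :
    l1norm (stepMatrix p π n y - stepMatrix q π n y) = l1norm (p n y - q n y) := by
  simp only [l1norm, Fintype.sum_prod_type, stepMatrix, Matrix.of_apply, Pi.sub_apply, ← sub_mul,
    abs_mul, abs_of_nonneg ((hπ n _).1 _), ← Finset.mul_sum, (hπ n _).2, mul_one]

variable [DecidableEq X] [DecidableEq A]

lemma visitCount_eq_count (τ : ℕ → Fin (N + 1) → X × A) (t : ℕ) (n : Fin N) (y : X × A) :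
    visitCount τ t n y = Nat.count (τ · n.castSucc = y) t :=
  (Nat.count_eq_card_filter_range _ t).symm

variable [Fintype X]

lemma stepMatrix_mem_rowStochastic [Fintype A] (hp : IsKernel p) (hπ : IsPolicy π) (n : Fin N) :
    stepMatrix p π n ∈ Matrix.rowStochastic ℝ (X × A) := by
  refine mem_rowStochastic_iff_forall_mem_stdSimplex.2 fun y =>
    ⟨fun z => mul_nonneg ((hp n y).1 _) ((hπ n _).1 _), ?_⟩
  simpa only [mul_one, (hp n y).2] using sum_stepMatrix_mul_fst p hπ n y fun _ => 1

lemma sum_ite_visit_eq_sum_transitionCount (τ : ℕ → Fin (N + 1) → X × A) (t : ℕ) (n : Fin N)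
    (y : X × A) (F : X → ℝ) :
    ∑ s ∈ Finset.range t, (if τ s n.castSucc = y then F (τ s n.succ).1 else 0) =
      ∑ x, transitionCount τ t n y x * F x := by
  simp only [transitionCount, Finset.card_filter, Nat.cast_sum, Finset.sum_mul]
  rw [Finset.sum_comm]
  refine Finset.sum_congr rfl fun s _ => ?_
  by_cases h : τ s n.castSucc = y <;> simp [h]

lemma sum_transitionCount (τ : ℕ → Fin (N + 1) → X × A) (t : ℕ) (n : Fin N) (y : X × A) :
    ∑ x, (transitionCount τ t n y x : ℝ) = visitCount τ t n y := by
  simpa [visitCount] using (sum_ite_visit_eq_sum_transitionCount τ t n y fun _ => 1).symm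

lemma visitCount_mul_empiricalKernel (τ : ℕ → Fin (N + 1) → X × A) (t : ℕ) (n : Fin N)
    (y : X × A) (x : X) :
    visitCount τ t n y * empiricalKernel τ t n y x = transitionCount τ t n y x := by
  rcases (visitCount τ t n y).eq_zero_or_pos with h | h
  · have htransition : transitionCount τ t n y x ≤ visitCount τ t n y :=
      Finset.card_le_card (Finset.monotone_filter_right _ fun _ _ hs => hs.1)
    rw [h, Nat.cast_zero, zero_mul, Nat.le_zero.1 (htransition.trans_eq h), Nat.cast_zero]
  · have h1 : (1 : ℝ) ≤ visitCount τ t n y := Nat.one_le_cast.2 h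
    rw [empiricalKernel, if_neg h.ne', max_eq_right h1, mul_div_cancel₀ _ (by linarith)]

lemma isKernel_empiricalKernel (τ : ℕ → Fin (N + 1) → X × A) (t : ℕ) :
    IsKernel (empiricalKernel τ t) := by
  intro n y
  have : Nonempty X := ⟨y.1⟩
  refine ⟨fun x => ?_, ?_⟩
  · rw [empiricalKernel]
    positivity
  · rcases eq_or_ne (visitCount τ t n y) 0 with h | h
    · simp [empiricalKernel, h]
    · refine mul_left_cancel₀ (Nat.cast_ne_zero.2 h) ?_
      simp only [Finset.mul_sum, visitCount_mul_empiricalKernel, sum_transitionCount, mul_one]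

/-- Stopping at the `m`-th visit of `y`, where `m` is the number of visits before time `t`, gives
a sum over all `T` episodes whose summands only involve the past. -/
lemma sum_ite_visitCount_lt_eq_mul_sum_empiricalKernel (τ : ℕ → Fin (N + 1) → X × A) {t T : ℕ}
    (ht : t ≤ T) (n : Fin N) (y : X × A) (F : X → ℝ) :
    ∑ s ∈ Finset.range T, (if visitCount τ s n y < visitCount τ t n y ∧ τ s n.castSucc = y
        then F (τ s n.succ).1 else 0) =
      visitCount τ t n y * ∑ x, empiricalKernel τ t n y x * F x := by
  simp only [visitCount_eq_count, sum_range_ite_count_lt_and (τ · n.castSucc = y) ht]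
  simp only [← visitCount_eq_count, sum_ite_visit_eq_sum_transitionCount, Finset.mul_sum,
    ← visitCount_mul_empiricalKernel, mul_assoc]

end Kernels

section InitialDistributions

variable {X A : Type*} [Fintype X] [DecidableEq X] {N T : ℕ}
  {p : Fin N → X × A → X → ℝ} {ρ : X × A → ℝ} {π : ℕ → Fin N → X → A → ℝ} {t : ℕ}

/-- The `L₁` error of the row `y` of the empirical kernel at the beginning of episode `t`. -/
noncomputable def rowError [DecidableEq A] (p : Fin N → X × A → X → ℝ)
    (τ : ℕ → Fin (N + 1) → X × A) (t : ℕ) (n : Fin N) (y : X × A) : ℝ :=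
  l1norm (p n y - empiricalKernel τ t n y)

/-- All rows of the empirical kernels of the first `T` episodes satisfy the confidence bound
`‖p_n(· | y) - p̃_{t,n}(· | y)‖₁ ≤ c / √k`, where `k` is the number of visits of `y`. Multiplying
by `√k` makes the bound void for `k = 0`. -/
def IsConfident [DecidableEq A] (p : Fin N → X × A → X → ℝ) (τ : ℕ → Fin (N + 1) → X × A) (T : ℕ)
    (c : ℝ) : Prop :=
  ∀ t < T, ∀ n y, √(visitCount τ t n y : ℝ) * rowError p τ t n y ≤ c

lemma rowError_le_two [DecidableEq A] (hp : IsKernel p) (τ : ℕ → Fin (N + 1) → X × A) (t : ℕ)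
    (n : Fin N) (y : X × A) : rowError p τ t n y ≤ 2 :=
  l1norm_sub_le_two (hp n y) (isKernel_empiricalKernel τ t n y)

variable [Fintype A] [DecidableEq A]

/-- The law of the trajectory of the restarted agent in episode `t`, given the past. -/
noncomputable def trajectoryLaw (p : Fin N → X × A → X → ℝ) (ρ : X × A → ℝ)
    (π : ℕ → Fin N → X → A → ℝ) (τ : ℕ → Fin (N + 1) → X × A) (t : ℕ) :
    (Fin (N + 1) → X × A) → ℝ :=
  pathWeight (estInit ρ π τ t) (stepMatrix p (π t))

/-- The expectation, given the past, of the error of the row that the trajectory of episode `t`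
visits at time `n`. -/
noncomputable def meanRowError (p : Fin N → X × A → X → ℝ) (ρ : X × A → ℝ)
    (π : ℕ → Fin N → X → A → ℝ) (τ : ℕ → Fin (N + 1) → X × A) (t : ℕ) (n : Fin N) : ℝ :=
  ∑ y, trajectoryLaw p ρ π τ t y * rowError p τ t n (y n.castSucc)

lemma trueInit_mem_stdSimplex (hp : IsKernel p) (hρ : ρ ∈ stdSimplex ℝ (X × A))
    (hπ : ∀ s < t, IsPolicy (π s)) : trueInit p ρ π t ∈ stdSimplex ℝ (X × A) := by
  induction t with
  | zero => exact hρ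
  | succ t ih =>
    exact vecMul_mem_stdSimplex (ih fun s hs => hπ s (hs.trans t.lt_succ_self))
      (prod_ofFn_mem_rowStochastic (stepMatrix_mem_rowStochastic hp (hπ t t.lt_succ_self)))

lemma estInit_mem_stdSimplex (hρ : ρ ∈ stdSimplex ℝ (X × A)) (τ : ℕ → Fin (N + 1) → X × A)
    (hπ : ∀ s < t, IsPolicy (π s)) : estInit ρ π τ t ∈ stdSimplex ℝ (X × A) := by
  induction t with
  | zero => exact hρ
  | succ t ih =>
    exact vecMul_mem_stdSimplex (ih fun s hs => hπ s (hs.trans t.lt_succ_self))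
      (prod_ofFn_mem_rowStochastic
        (stepMatrix_mem_rowStochastic (isKernel_empiricalKernel τ t) (hπ t t.lt_succ_self)))

lemma trajectoryLaw_mem_stdSimplex (hp : IsKernel p) (hρ : ρ ∈ stdSimplex ℝ (X × A))
    (τ : ℕ → Fin (N + 1) → X × A) (hπ : ∀ s ≤ t, IsPolicy (π s)) :
    trajectoryLaw p ρ π τ t ∈ stdSimplex ℝ (Fin (N + 1) → X × A) := by
  have hest := estInit_mem_stdSimplex hρ τ fun s hs => hπ s hs.le
  have hstep := stepMatrix_mem_rowStochastic hp (hπ t le_rfl)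
  exact ⟨pathWeight_nonneg hest.1 fun n => (hstep n).1, (sum_pathWeight _ hstep).trans hest.2⟩

lemma l1norm_vecMul_episodeMatrix_sub_le (hp : IsKernel p) (hρ : ρ ∈ stdSimplex ℝ (X × A))
    (τ : ℕ → Fin (N + 1) → X × A) (hπ : ∀ s ≤ t, IsPolicy (π s)) :
    l1norm (estInit ρ π τ t ᵥ* episodeMatrix p (π t) -
        estInit ρ π τ t ᵥ* episodeMatrix (empiricalKernel τ t) (π t)) ≤
      ∑ n, meanRowError p ρ π τ t n := by
  refine (l1norm_vecMul_prod_sub_le (estInit_mem_stdSimplex hρ τ fun s hs => hπ s hs.le).1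
    (stepMatrix_mem_rowStochastic hp (hπ t le_rfl))
    (stepMatrix_mem_rowStochastic (isKernel_empiricalKernel τ t) (hπ t le_rfl))).trans_eq ?_
  simp only [l1norm_stepMatrix_sub _ _ (hπ t le_rfl), meanRowError, trajectoryLaw, rowError]

lemma sum_le_of_contraction {α : ℝ} (hα1 : α < 1) {d e : ℕ → ℝ} (hd : ∀ t, 0 ≤ d t)
    (hd0 : d 0 = 0) (h : ∀ t < T, d (t + 1) ≤ α * d t + e t) :
    ∑ t ∈ Finset.range T, d t ≤ (1 - α)⁻¹ * ∑ t ∈ Finset.range T, e t := by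
  have hshift : ∑ t ∈ Finset.range T, d t ≤ ∑ t ∈ Finset.range T, d (t + 1) := by
    linarith [Finset.sum_range_succ' d T, Finset.sum_range_succ d T, hd T]
  have hstep : ∑ t ∈ Finset.range T, d (t + 1) ≤
      α * ∑ t ∈ Finset.range T, d t + ∑ t ∈ Finset.range T, e t := by
    rw [Finset.mul_sum, ← Finset.sum_add_distrib]
    exact Finset.sum_le_sum fun t ht => h t (Finset.mem_range.1 ht)
  rw [inv_mul_eq_div, le_div_iff₀ (by linarith)]
  linarith

lemma sum_l1norm_trueInit_sub_estInit_le (hp : IsKernel p) (hρ : ρ ∈ stdSimplex ℝ (X × A)) {α : ℝ}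
    (hα1 : α < 1) (hα : AllPolicyContraction p α) (τ : ℕ → Fin (N + 1) → X × A)
    (hπ : ∀ t < T, IsPolicy (π t)) :
    ∑ t ∈ Finset.range T, l1norm (trueInit p ρ π t - estInit ρ π τ t) ≤
      (1 - α)⁻¹ * ∑ n, ∑ t ∈ Finset.range T, meanRowError p ρ π τ t n := by
  rw [Finset.sum_comm]
  refine sum_le_of_contraction hα1 (fun t => l1norm_nonneg _) (by simp [trueInit, estInit])
    fun t ht => ?_
  have hπ' : ∀ s ≤ t, IsPolicy (π s) := fun s hs => hπ s (hs.trans_lt ht)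
  have htrue := trueInit_mem_stdSimplex hp hρ fun s hs => hπ' s hs.le
  have hest := estInit_mem_stdSimplex hρ τ fun s hs => hπ' s hs.le
  rw [trueInit, estInit, ← sub_add_sub_cancel _ (estInit ρ π τ t ᵥ* episodeMatrix p (π t))]
  exact (l1norm_add_le _ _).trans (add_le_add (hα _ (hπ t ht) _ htrue _ hest)
    (l1norm_vecMul_episodeMatrix_sub_le hp hρ τ hπ'))

lemma sum_l1norm_trueInit_sub_estInit_nonpos_of_degenerate (hp : IsKernel p)
    (hρ : ρ ∈ stdSimplex ℝ (X × A)) {α : ℝ} (hα1 : α < 1) (hα : AllPolicyContraction p α)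
    (τ : ℕ → Fin (N + 1) → X × A) (hπ : ∀ t < T, IsPolicy (π t))
    (h : N = 0 ∨ T ≤ 1 ∨ Fintype.card X ≤ 1) :
    ∑ t ∈ Finset.range T, l1norm (trueInit p ρ π t - estInit ρ π τ t) ≤ 0 := by
  rcases h with rfl | hT | hX
  · simpa using sum_l1norm_trueInit_sub_estInit_le hp hρ hα1 hα τ hπ
  · refine (Finset.sum_eq_zero fun t ht => ?_).le
    obtain rfl : t = 0 := by have := Finset.mem_range.1 ht; omega
    simp [trueInit, estInit]
  · have := Fintype.card_le_one_iff_subsingleton.1 hX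
    have hzero : ∀ t n y, rowError p τ t n y = 0 := fun t n y => by
      have : Nonempty X := ⟨y.1⟩
      have hrow := hp n y
      have hemp := isKernel_empiricalKernel τ t n y
      rw [stdSimplex_unique, Set.mem_singleton_iff] at hrow hemp
      rw [rowError, hrow, hemp, sub_self, l1norm_zero]
    simpa only [meanRowError, hzero, mul_zero, Finset.sum_const_zero] using
      sum_l1norm_trueInit_sub_estInit_le hp hρ hα1 hα τ hπ

lemma IsConfident.sum_rowError_le (hp : IsKernel p) {τ : ℕ → Fin (N + 1) → X × A} {c : ℝ}
    (hc : 2 / 3 ≤ c) (h : IsConfident p τ T c) (n : Fin N) :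
    ∑ t ∈ Finset.range T, rowError p τ t n (τ t n.castSucc) ≤
      3 * c * √(Fintype.card X * Fintype.card A * T) := by
  set e : ℕ → ℝ := fun k => if k = 0 then 2 else c / √(k : ℝ) with he
  have hwidth : ∀ t < T, ∀ y, rowError p τ t n y ≤ e (visitCount τ t n y) := fun t ht y => by
    simp only [he]
    split_ifs with hk
    · exact rowError_le_two hp τ t n y
    · have hsqrt := Real.sqrt_pos.2 (Nat.cast_pos.2 (Nat.pos_of_ne_zero hk))
      exact (le_div_iff₀' hsqrt).2 (h t ht n y)
  have hscaled : ∀ k : ℕ, √(k : ℝ) * e k ≤ c := fun k => by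
    simp only [he]
    split_ifs with hk
    · simp only [hk, Nat.cast_zero, Real.sqrt_zero, zero_mul]
      linarith
    · have hsqrt := Real.sqrt_pos.2 (Nat.cast_pos.2 (Nat.pos_of_ne_zero hk))
      exact (mul_div_cancel₀ _ hsqrt.ne').le
  have hsum := sum_comp_count_le (by linarith) (by simp only [he, if_true]; linarith) hscaled
    (τ · n.castSucc) T
  simp only [Fintype.card_prod, Nat.cast_mul, ← visitCount_eq_count] at hsum
  exact (Finset.sum_le_sum fun t ht => hwidth t (Finset.mem_range.1 ht) _).trans hsum

end InitialDistributions

section Measurability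

variable {Ω : Type*} {m : MeasurableSpace Ω} {t N : ℕ}

lemma measurableSet_mem_of_forall_eq {Y : Type*} [Finite Y] {z : Ω → Y}
    (hz : ∀ y, MeasurableSet {ω | z ω = y}) (S : Set Y) : MeasurableSet {ω | z ω ∈ S} := by
  have hunion : {ω | z ω ∈ S} = ⋃ y ∈ S, {ω | z ω = y} := by
    ext ω
    simp
  rw [hunion]
  exact .biUnion (Set.to_countable S) fun y _ => hz y

lemma measurable_prod_ofFn {Y : Type*} [Fintype Y] [DecidableEq Y]
    {K : Ω → Fin N → Matrix Y Y ℝ} (hK : ∀ n a b, Measurable fun ω => K ω n a b) (a b : Y) :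
    Measurable fun ω => (List.ofFn (K ω)).prod a b := by
  induction N generalizing a with
  | zero => simp
  | succ N ih =>
    simp only [List.ofFn_succ, List.prod_cons, Matrix.mul_apply]
    exact Finset.measurable_sum _ fun c _ =>
      (hK 0 a c).mul (ih (K := fun ω n => K ω n.succ) (fun n => hK n.succ) c)

variable {X A : Type*} [DecidableEq X] [DecidableEq A] {τ : ℕ → Ω → Fin (N + 1) → X × A}

lemma measurable_visitCount [Finite X] [Finite A]
    (hτ : ∀ s < t, ∀ y, MeasurableSet {ω | τ s ω = y}) (n : Fin N) (y : X × A) :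
    Measurable fun ω => visitCount (τ · ω) t n y := by
  simp only [visitCount, Finset.card_filter]
  exact Finset.measurable_sum _ fun s hs => Measurable.ite
    (measurableSet_mem_of_forall_eq (hτ s (Finset.mem_range.1 hs)) {z | z n.castSucc = y})
    measurable_const measurable_const

lemma measurable_transitionCount [Finite X] [Finite A]
    (hτ : ∀ s < t, ∀ y, MeasurableSet {ω | τ s ω = y}) (n : Fin N) (y : X × A) (x : X) :
    Measurable fun ω => transitionCount (τ · ω) t n y x := by
  simp only [transitionCount, Finset.card_filter]
  exact Finset.measurable_sum _ fun s hs => Measurable.ite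
    (measurableSet_mem_of_forall_eq (hτ s (Finset.mem_range.1 hs))
      {z | z n.castSucc = y ∧ (z n.succ).1 = x})
    measurable_const measurable_const

lemma measurable_empiricalKernel [Fintype X] [Finite A]
    (hτ : ∀ s < t, ∀ y, MeasurableSet {ω | τ s ω = y}) (n : Fin N) (y : X × A) (x : X) :
    Measurable fun ω => empiricalKernel (τ · ω) t n y x := by
  have hvisit := measurable_visitCount hτ n y
  have htransition := measurable_transitionCount hτ n y x
  exact Measurable.ite (hvisit (measurableSet_singleton 0)) measurable_const
    ((measurable_from_top.comp htransition).div
      (measurable_const.max (measurable_from_top.comp hvisit)))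

lemma measurable_rowError [Fintype X] [Finite A] (p : Fin N → X × A → X → ℝ)
    (hτ : ∀ s < t, ∀ y, MeasurableSet {ω | τ s ω = y}) (n : Fin N) (y : X × A) :
    Measurable fun ω => rowError p (τ · ω) t n y :=
  Finset.measurable_sum _ fun x _ => ((measurable_empiricalKernel hτ n y x).const_sub _).abs

lemma measurable_estInit [Fintype X] [Fintype A] {π : ℕ → Ω → Fin N → X → A → ℝ} (ρ : X × A → ℝ)
    (hπ : ∀ s < t, ∀ n x a, Measurable fun ω => π s ω n x a)
    (hτ : ∀ s < t, ∀ y, MeasurableSet {ω | τ s ω = y}) (y : X × A) :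
    Measurable fun ω => estInit ρ (π · ω) (τ · ω) t y := by
  induction t generalizing y with
  | zero => exact measurable_const
  | succ t ih =>
    have hτ' : ∀ s < t, ∀ y, MeasurableSet {ω | τ s ω = y} := fun s hs =>
      hτ s (hs.trans t.lt_succ_self)
    simp only [estInit, Matrix.vecMul, dotProduct]
    exact Finset.measurable_sum _ fun z _ =>
      (ih (fun s hs => hπ s (hs.trans t.lt_succ_self)) hτ' z).mul
        (measurable_prod_ofFn (fun n a b => (measurable_empiricalKernel hτ' n a b.1).mul
          (hπ t t.lt_succ_self n b.1 b.2)) z y)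

end Measurability

section FailureProbabilities

lemma sum_mul_sub_sub_of_sum_eq_one {ι : Type*} [Fintype ι] {w : ι → ℝ} (hw : ∑ i, w i = 1)
    (f : ι → ℝ) (l μ v : ℝ) :
    ∑ i, w i * (l * (f i - μ) - v) = l * (∑ i, w i * f i - μ) - v := by
  calc ∑ i, w i * (l * (f i - μ) - v) = ∑ i, (l * (w i * f i) - w i * (l * μ + v)) :=
        Finset.sum_congr rfl fun i _ => by ring
    _ = l * (∑ i, w i * f i - μ) - v := by
        rw [Finset.sum_sub_distrib, ← Finset.mul_sum, ← Finset.sum_mul, hw]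
        ring

variable {X A : Type*} [Fintype X] [Fintype A] [DecidableEq X] [DecidableEq A]
  {N T : ℕ} {p : Fin N → X × A → X → ℝ} {ρ : X × A → ℝ}

lemma sum_trajectoryLaw_mul_exp_ite_le_one (hp : IsKernel p) (hρ : ρ ∈ stdSimplex ℝ (X × A))
    {π : ℕ → Fin N → X → A → ℝ} (τ : ℕ → Fin (N + 1) → X × A) {t : ℕ}
    (hπ : ∀ s ≤ t, IsPolicy (π s)) (n : Fin N) (y : X × A) {F : X → ℝ}
    (hF : ∑ x, p n y x * Real.exp (F x) ≤ 1) (P : Prop) [Decidable P] :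
    ∑ z, trajectoryLaw p ρ π τ t z *
      Real.exp (if P ∧ z n.castSucc = y then F (z n.succ).1 else 0) ≤ 1 := by
  have hstep := stepMatrix_mem_rowStochastic hp (hπ t le_rfl)
  refine sum_pathWeight_mul_castSucc_succ_le (estInit_mem_stdSimplex hρ τ fun s hs => hπ s hs.le)
    hstep n (φ := fun a b => Real.exp (if P ∧ a = y then F b.1 else 0)) fun a => ?_
  by_cases hvisit : P ∧ a = y
  · simp only [if_pos hvisit]
    rwa [hvisit.2, sum_stepMatrix_mul_fst p (hπ t le_rfl) n y fun x => Real.exp (F x)]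
  · simp only [if_neg hvisit, Real.exp_zero, mul_one]
    exact (Matrix.sum_row_of_mem_rowStochastic (hstep n) a).le

variable {Ω : Type*} {mΩ : MeasurableSpace Ω} {ℙ : Measure Ω} {𝓖 : Filtration ℕ mΩ}
  {π : ℕ → Ω → Fin N → X → A → ℝ} {τ : ℕ → Ω → Fin (N + 1) → X × A}

namespace IsRestartProtocol

lemma hasCondLaw (h : IsRestartProtocol ℙ 𝓖 T p ρ π τ) :
    HasCondLaw ℙ 𝓖 T τ fun t ω => trajectoryLaw p ρ (π · ω) (τ · ω) t :=
  ⟨h.measurable_trajectory, h.law_trajectory⟩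

lemma measurableSet_of_lt (h : IsRestartProtocol ℙ 𝓖 T p ρ π τ) {t : ℕ} (ht : t < T) :
    ∀ s < t, ∀ y, MeasurableSet[𝓖 t] {ω | τ s ω = y} := fun s hs y =>
  𝓖.mono (Nat.succ_le_of_lt hs) _ (h.measurable_trajectory s (hs.trans ht) y)

lemma isPolicy_of_le (h : IsRestartProtocol ℙ 𝓖 T p ρ π τ) {t : ℕ} (ht : t < T) (ω : Ω) :
    ∀ s ≤ t, IsPolicy (π s ω) := fun s hs => h.isPolicy s (hs.trans_lt ht) ω

lemma measurable_trajectoryLaw (h : IsRestartProtocol ℙ 𝓖 T p ρ π τ) {t : ℕ} (ht : t < T)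
    (y : Fin (N + 1) → X × A) :
    Measurable[𝓖 t] fun ω => trajectoryLaw p ρ (π · ω) (τ · ω) t y :=
  (measurable_estInit (m := 𝓖 t) ρ (fun s hs n x a =>
    (h.measurable_policy s (hs.trans ht) n x a).mono (𝓖.mono hs.le) le_rfl)
    (h.measurableSet_of_lt ht) _).mul
      (Finset.measurable_prod _ fun n _ => (h.measurable_policy t ht n _ _).const_mul _)

variable [IsProbabilityMeasure ℙ]

lemma measureReal_exists_le_mul_sum_empiricalKernel_le (h : IsRestartProtocol ℙ 𝓖 T p ρ π τ)
    (hp : IsKernel p) (hρ : ρ ∈ stdSimplex ℝ (X × A)) (n : Fin N) (y : X × A) {F : X → ℝ}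
    (hF : ∑ x, p n y x * Real.exp (F x) ≤ 1) (m : ℕ) (u : ℝ) :
    ℙ.real {ω | ∃ t < T, visitCount (τ · ω) t n y = m ∧
      u ≤ m * ∑ x, empiricalKernel (τ · ω) t n y x * F x} ≤ Real.exp (-u) := by
  obtain ⟨C, hC⟩ := (Set.finite_range F).bddAbove
  have htail := h.hasCondLaw.measureReal_le_sum_le_exp_neg (C := max C 0)
    (g := fun t z ω => if visitCount (τ · ω) t n y < m ∧ z n.castSucc = y
      then F (z n.succ).1 else 0)
    (fun t ht z => .ite ((measurable_visitCount (m := 𝓖 t) (h.measurableSet_of_lt ht) n y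
      measurableSet_Iio).inter (.const _)) measurable_const measurable_const)
    (fun t _ z ω => by
      split_ifs
      · exact le_max_of_le_left (hC (Set.mem_range_self _))
      · exact le_max_right _ _)
    (fun t ht ω => sum_trajectoryLaw_mul_exp_ite_le_one hp hρ _ (h.isPolicy_of_le ht ω) n y hF _) u
  refine (measureReal_mono ?_).trans htail
  rintro ω ⟨t, ht, rfl, hu⟩
  exact hu.trans_eq (sum_ite_visitCount_lt_eq_mul_sum_empiricalKernel _ ht.le n y F).symm

/-- The union over the sign patterns `S` of the errors of a row reduces the `L₁` deviation to
Hoeffding's inequality. -/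
lemma measureReal_exists_le_sqrt_mul_rowError_le (h : IsRestartProtocol ℙ 𝓖 T p ρ π τ)
    (hp : IsKernel p) (hρ : ρ ∈ stdSimplex ℝ (X × A)) (n : Fin N) (y : X × A) (m : ℕ) {c : ℝ}
    (hc : 0 ≤ c) :
    ℙ.real {ω | ∃ t < T, visitCount (τ · ω) t n y = m ∧ c ≤ √(m : ℝ) * rowError p (τ · ω) t n y} ≤
      2 ^ Fintype.card X * Real.exp (-(c ^ 2 / 2)) := by
  set l : ℝ := c / √(m : ℝ)
  set σ : Finset X → X → ℝ := fun S x => if x ∈ S then 1 else -1 with hσ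
  set F : Finset X → X → ℝ := fun S x =>
    -l * (σ S x - ∑ x', p n y x' * σ S x') - (-l) ^ 2 * (1 - -1) ^ 2 / 8
  have hF : ∀ S, ∑ x, p n y x * Real.exp (F S x) ≤ 1 := fun S =>
    sum_mul_exp_sub_le_one (hp n y)
      (fun x => by by_cases hx : x ∈ S <;> norm_num [hσ, hx]) (-l)
  refine (measureReal_mono (s₂ := ⋃ S, _) ?_).trans ((measureReal_iUnion_fintype_le _).trans
    ((Finset.sum_le_sum fun S _ => h.measureReal_exists_le_mul_sum_empiricalKernel_le hp hρ n y
      (hF S) m (c ^ 2 / 2)).trans_eq ?_))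
  · rintro ω ⟨t, ht, hm, hle⟩
    obtain ⟨S, hS⟩ := exists_finset_l1norm_eq_sum_sign (p n y - empiricalKernel (τ · ω) t n y)
    refine Set.mem_iUnion.2 ⟨S, t, ht, hm, ?_⟩
    have hmean : ∑ x, empiricalKernel (τ · ω) t n y x * F S x =
        l * rowError p (τ · ω) t n y - l ^ 2 / 2 := by
      rw [sum_mul_sub_sub_of_sum_eq_one (isKernel_empiricalKernel (τ · ω) t n y).2, rowError, hS]
      simp only [Pi.sub_apply, sub_mul, Finset.sum_sub_distrib, hσ]
      ring
    have hlm : l * √(m : ℝ) = c := div_mul_cancel_of_imp fun hm0 => by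
      rw [hm0, zero_mul] at hle
      exact hle.antisymm hc
    rw [hmean, ← Real.sq_sqrt m.cast_nonneg]
    have hdev := mul_le_mul_of_nonneg_left hle hc
    nth_rewrite 2 [← hlm] at hdev
    nlinarith
  · simp

lemma measureReal_le_sum_meanRowError_sub_le (h : IsRestartProtocol ℙ 𝓖 T p ρ π τ)
    (hp : IsKernel p) (hρ : ρ ∈ stdSimplex ℝ (X × A)) (n : Fin N) {ε : ℝ} (hε : 0 ≤ ε) :
    ℙ.real {ω | ε ≤ ∑ t ∈ Finset.range T, (meanRowError p ρ (π · ω) (τ · ω) t n -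
      rowError p (τ · ω) t n (τ t ω n.castSucc))} ≤ Real.exp (-(ε ^ 2 / (2 * T))) := by
  have hazuma := h.hasCondLaw.measureReal_le_sum_mean_sub_le
    (fun t ht ω => trajectoryLaw_mem_stdSimplex hp hρ _ (h.isPolicy_of_le ht ω))
    (fun t ht y => h.measurable_trajectoryLaw ht y)
    (D := fun t y ω => rowError p (τ · ω) t n (y n.castSucc))
    (fun t ht y => measurable_rowError (m := 𝓖 t) p (h.measurableSet_of_lt ht) n _)
    (fun t _ y ω => ⟨l1norm_nonneg _, rowError_le_two hp _ t n _⟩) hε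
  have hconst : 2 * ε ^ 2 / (T * (2 - 0) ^ 2) = ε ^ 2 / (2 * T) := by
    rw [← mul_div_mul_left (ε ^ 2) (2 * T : ℝ) two_ne_zero]
    ring_nf
  rwa [hconst] at hazuma

lemma measureReal_exists_lt_sum_meanRowError_sub_le (h : IsRestartProtocol ℙ 𝓖 T p ρ π τ)
    (hp : IsKernel p) (hρ : ρ ∈ stdSimplex ℝ (X × A)) {ε : ℝ} (hε : 0 ≤ ε) :
    ℙ.real {ω | ∃ n, ε < ∑ t ∈ Finset.range T, (meanRowError p ρ (π · ω) (τ · ω) t n -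
      rowError p (τ · ω) t n (τ t ω n.castSucc))} ≤ N * Real.exp (-(ε ^ 2 / (2 * T))) := by
  refine (measureReal_mono (s₂ := ⋃ n, _) ?_).trans ((measureReal_iUnion_fintype_le _).trans
    ((Finset.sum_le_sum fun n _ =>
      h.measureReal_le_sum_meanRowError_sub_le hp hρ n hε).trans_eq ?_))
  · rintro ω ⟨n, hn⟩
    exact Set.mem_iUnion.2 ⟨n, hn.le⟩
  · simp

lemma measureReal_not_isConfident_le (h : IsRestartProtocol ℙ 𝓖 T p ρ π τ)
    (hp : IsKernel p) (hρ : ρ ∈ stdSimplex ℝ (X × A)) {c : ℝ} (hc : 0 ≤ c) :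
    ℙ.real {ω | ¬ IsConfident p (τ · ω) T c} ≤ Fintype.card X * Fintype.card A * N * T *
      (2 ^ Fintype.card X * Real.exp (-(c ^ 2 / 2))) := by
  refine (measureReal_mono (s₂ := ⋃ i : Fin N × (X × A) × Fin T, _) ?_).trans
    ((measureReal_iUnion_fintype_le _).trans ((Finset.sum_le_sum fun i _ =>
      h.measureReal_exists_le_sqrt_mul_rowError_le hp hρ i.1 i.2.1 i.2.2 hc).trans_eq ?_))
  · intro ω hω
    simp only [Set.mem_ofPred_eq, IsConfident] at hω
    push Not at hω
    obtain ⟨t, ht, n, y, hlt⟩ := hω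
    have hvisit : visitCount (τ · ω) t n y < T :=
      ((visitCount_eq_count _ t n y).trans_le (Nat.count_le _)).trans_lt ht
    exact Set.mem_iUnion.2 ⟨(n, y, ⟨_, hvisit⟩), t, ht, rfl, hlt.le⟩
  · simp only [Finset.sum_const, Finset.card_univ, Fintype.card_prod, Fintype.card_fin,
      nsmul_eq_mul, Nat.cast_mul]
    ring

lemma one_sub_le_measureReal_sum_l1norm_trueInit_sub_estInit_le
    (h : IsRestartProtocol ℙ 𝓖 T p ρ π τ) (hp : IsKernel p) (hρ : ρ ∈ stdSimplex ℝ (X × A))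
    {α : ℝ} (hα1 : α < 1) (hα : AllPolicyContraction p α) {c ε : ℝ} (hc : 2 / 3 ≤ c)
    (hε : 0 ≤ ε) :
    1 - (N * Real.exp (-(ε ^ 2 / (2 * T))) + Fintype.card X * Fintype.card A * N * T *
        (2 ^ Fintype.card X * Real.exp (-(c ^ 2 / 2)))) ≤
      ℙ.real {ω | ∑ t ∈ Finset.range T,
          l1norm (trueInit p ρ (π · ω) t - estInit ρ (π · ω) (τ · ω) t) ≤
        (1 - α)⁻¹ * (N * (3 * c * √(Fintype.card X * Fintype.card A * T) + ε))} := by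
  refine (sub_le_sub_left (add_le_add (h.measureReal_exists_lt_sum_meanRowError_sub_le hp hρ hε)
    (h.measureReal_not_isConfident_le hp hρ (by linarith))) 1).trans
    (one_sub_le_measureReal_of_compl_subset fun ω hω => ?_)
  contrapose! hω
  simp only [Set.mem_union, Set.mem_ofPred_eq, not_or, not_exists, not_lt, not_not,
    Set.mem_compl_iff] at hω ⊢
  obtain ⟨hmean, hconf⟩ := hω
  refine (sum_l1norm_trueInit_sub_estInit_le hp hρ hα1 hα (τ · ω)
    fun t ht => h.isPolicy t ht ω).trans (mul_le_mul_of_nonneg_left ?_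
      (inv_nonneg.2 (by linarith)))
  have hstep : ∀ n, ∑ t ∈ Finset.range T, meanRowError p ρ (π · ω) (τ · ω) t n ≤
      3 * c * √(Fintype.card X * Fintype.card A * T) + ε := fun n => by
    have hn := hmean n
    rw [Finset.sum_sub_distrib] at hn
    linarith [hconf.sum_rowError_le hp hc n]
  refine (Finset.sum_le_card_nsmul Finset.univ _ _ fun n _ => hstep n).trans_eq ?_
  rw [Finset.card_univ, Fintype.card_fin, nsmul_eq_mul]

end IsRestartProtocol

end FailureProbabilities

section Constants

lemma mul_exp_neg_sq_sqrt_two_mul_log_div {s a δ : ℝ} (hs : 0 < s) (hδ : 0 < δ) (ha : δ ≤ a) :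
    a * Real.exp (-(√(2 * s * Real.log (a / δ)) ^ 2 / (2 * s))) = δ := by
  have ha0 : 0 < a := hδ.trans_le ha
  have hlog : 0 ≤ Real.log (a / δ) := Real.log_nonneg ((one_le_div hδ).2 ha)
  rw [Real.sq_sqrt (by positivity), mul_div_cancel_left₀ _ (by positivity), Real.exp_neg,
    Real.exp_log (by positivity), inv_div, mul_div_cancel₀ _ ha0.ne']

lemma mul_two_pow_mul_exp_neg_sq_sqrt_le_one {k : ℕ} (hk : 2 ≤ k) {K : ℝ} (hK : 4 ≤ K) :
    K * (2 ^ k * Real.exp (-(√(2 * k * Real.log K) ^ 2 / 2))) ≤ 1 := by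
  have hlog : 0 ≤ Real.log K := Real.log_nonneg (by linarith)
  have hexp : Real.exp (-(√(2 * k * Real.log K) ^ 2 / 2)) = (K ^ k)⁻¹ := by
    rw [Real.sq_sqrt (by positivity), mul_assoc, mul_div_cancel_left₀ _ two_ne_zero, Real.exp_neg,
      Real.exp_nat_mul, Real.exp_log (by linarith)]
  have hpow : K * 2 ^ k ≤ K ^ k := by
    obtain ⟨j, rfl⟩ := Nat.exists_eq_add_of_le hk
    calc K * 2 ^ (2 + j) = K * 4 * 2 ^ j := by ring
      _ ≤ K * K * K ^ j := by gcongr; linarith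
      _ = K ^ (2 + j) := by ring
  rw [hexp, ← mul_assoc, ← div_eq_mul_inv]
  exact div_le_one_of_le₀ hpow (by positivity)

lemma two_thirds_le_sqrt_two_mul_log {s K : ℝ} (hs : 1 ≤ s) (hK : 4 ≤ K) :
    2 / 3 ≤ √(2 * s * Real.log K) := by
  have hinv : K⁻¹ ≤ 4⁻¹ := inv_anti₀ (by norm_num) hK
  have hlog : 3 / 4 ≤ Real.log K := by
    linarith [Real.one_sub_inv_le_log_of_pos (show 0 < K by linarith)]
  refine Real.le_sqrt_of_sq_le ?_
  nlinarith

lemma sqrt_two_mul_mul_sqrt_mul {x a t L : ℝ} (hx : 0 ≤ x) (hL : 0 ≤ L) :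
    √(2 * x * L) * √(x * a * t) = x * √(2 * a * t * L) := by
  calc √(2 * x * L) * √(x * a * t) = √(x ^ 2 * (2 * a * t * L)) := by
        rw [← Real.sqrt_mul (by positivity)]
        ring_nf
    _ = x * √(2 * a * t * L) := by rw [Real.sqrt_mul (sq_nonneg x), Real.sqrt_sq hx]

lemma four_le_mul_div {x a n t : ℕ} (hx : 2 ≤ x) (ha : 1 ≤ a) (hn : 1 ≤ n) (ht : 2 ≤ t) {δ : ℝ}
    (hδ0 : 0 < δ) (hδ1 : δ ≤ 1) : (4 : ℝ) ≤ x * a * n * t / δ := by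
  rw [le_div_iff₀ hδ0]
  have hnat : 2 * 1 * 1 * 2 ≤ x * a * n * t := by gcongr
  have hreal : (4 : ℝ) ≤ x * a * n * t := by exact_mod_cast hnat
  linarith

end Constants

section HighProbabilityBound

variable {X A : Type*} [Fintype X] [Fintype A] [DecidableEq X] [DecidableEq A]
  {N T : ℕ} {p : Fin N → X × A → X → ℝ} {ρ : X × A → ℝ}
  {Ω : Type*} {mΩ : MeasurableSpace Ω} {ℙ : Measure Ω} [IsProbabilityMeasure ℙ]
  {𝓖 : Filtration ℕ mΩ} {π : ℕ → Ω → Fin N → X → A → ℝ} {τ : ℕ → Ω → Fin (N + 1) → X × A}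

/-- With `K = |X| |A| N T / δ`, each of the two failure probabilities is at most `δ` for the choices
`c = √(2 |X| log K)` and `ε = √(2 T log (N / δ))`; that `4 ≤ K` absorbs the factor `2 ^ |X|` of the
union over sign patterns. -/
lemma IsRestartProtocol.one_sub_two_mul_le_measureReal (h : IsRestartProtocol ℙ 𝓖 T p ρ π τ)
    (hp : IsKernel p) (hρ : ρ ∈ stdSimplex ℝ (X × A)) {α : ℝ} (hα1 : α < 1)
    (hα : AllPolicyContraction p α) (hN : 1 ≤ N) (hT : 2 ≤ T) (hX : 2 ≤ Fintype.card X) {δ : ℝ}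
    (hδ0 : 0 < δ) (hδ1 : δ ≤ 1) :
    1 - 2 * δ ≤ ℙ.real {ω | ∑ t ∈ Finset.range T,
        l1norm (trueInit p ρ (π · ω) t - estInit ρ (π · ω) (τ · ω) t) ≤
      (1 - α)⁻¹ * (N * (3 * (Fintype.card X * √(2 * Fintype.card A * T *
          Real.log (Fintype.card X * Fintype.card A * N * T / δ))) +
        √(2 * T * Real.log (N / δ))))} := by
  have hA : 1 ≤ Fintype.card A := by
    obtain ⟨y⟩ : Nonempty (X × A) := not_isEmpty_iff.1 fun _ => by simpa using hρ.2
    exact Fintype.card_pos_iff.2 ⟨y.2⟩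
  set K : ℝ := Fintype.card X * Fintype.card A * N * T / δ
  have hKδ : Fintype.card X * Fintype.card A * N * T = K * δ := (div_mul_cancel₀ _ hδ0.ne').symm
  have hK : 4 ≤ K := four_le_mul_div hX hA hN hT hδ0 hδ1
  have hN1 : (1 : ℝ) ≤ N := Nat.one_le_cast.2 hN
  have hX1 : (1 : ℝ) ≤ Fintype.card X := Nat.one_le_cast.2 (by omega)
  have hbound := h.one_sub_le_measureReal_sum_l1norm_trueInit_sub_estInit_le hp hρ hα1 hα
    (two_thirds_le_sqrt_two_mul_log hX1 hK) (Real.sqrt_nonneg (2 * T * Real.log (N / δ)))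
  rw [mul_exp_neg_sq_sqrt_two_mul_log_div (Nat.cast_pos.2 (by omega)) hδ0 (hδ1.trans hN1), hKδ,
    mul_assoc 3, sqrt_two_mul_mul_sqrt_mul (by positivity) (Real.log_nonneg (by linarith))]
    at hbound
  have hconf := mul_le_mul_of_nonneg_right (mul_two_pow_mul_exp_neg_sq_sqrt_le_one hX hK) hδ0.le
  exact (show 1 - 2 * δ ≤ _ by linarith).trans hbound

end HighProbabilityBound

end PeriodicMDP

open PeriodicMDP

theorem mainTheorem3 {X A : Type*} [Fintype X] [Fintype A] [DecidableEq X] [DecidableEq A]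
    {Ω : Type*} {mΩ : MeasurableSpace Ω} (ℙ : Measure Ω) [IsProbabilityMeasure ℙ]
    (𝓖 : Filtration ℕ mΩ) (N T : ℕ)
    (p : Fin N → X × A → X → ℝ) (hp : PeriodicMDP.IsKernel p)
    (ρ : X × A → ℝ) (hρ : ρ ∈ stdSimplex ℝ (X × A))
    (α : ℝ) (hα0 : 0 ≤ α) (hα1 : α < 1) (hα : PeriodicMDP.AllPolicyContraction p α)
    (π : ℕ → Ω → Fin N → X → A → ℝ) (τ : ℕ → Ω → Fin (N + 1) → X × A)
    (h : PeriodicMDP.IsRestartProtocol ℙ 𝓖 T p ρ π τ)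
    (δ : ℝ) (hδ0 : 0 < δ) (hδ1 : δ < 1) :
    1 - 2 * δ ≤ ℙ.real {ω |
      ∑ t ∈ Finset.range T,
        PeriodicMDP.l1norm (PeriodicMDP.trueInit p ρ (fun s => π s ω) t -
          PeriodicMDP.estInit ρ (fun s => π s ω) (fun s => τ s ω) t)
      ≤ (1 - α)⁻¹ *
        (3 * N * Fintype.card X *
            √(2 * Fintype.card A * T *
              Real.log (Fintype.card X * Fintype.card A * N * T / δ)) +
          2 * N * Fintype.card X * √(2 * T * Real.log (N / δ)))} := by
  have hinv : 0 ≤ (1 - α)⁻¹ := inv_nonneg.2 (by linarith)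
  by_cases hdeg : N = 0 ∨ T ≤ 1 ∨ Fintype.card X ≤ 1
  · refine (sub_le_self 1 (by positivity)).trans (probReal_univ.symm.trans_le
      (measureReal_mono fun ω _ => ?_))
    exact (sum_l1norm_trueInit_sub_estInit_nonpos_of_degenerate hp hρ hα1 hα (τ · ω)
      (fun t ht => h.isPolicy t ht ω) hdeg).trans (by positivity)
  · push Not at hdeg
    obtain ⟨hN, hT, hX⟩ := hdeg
    refine (h.one_sub_two_mul_le_measureReal hp hρ hα1 hα (by omega) hT hX hδ0 hδ1.le).trans
      (measureReal_mono (Set.ofPred_subset_ofPred.2 fun ω hω => hω.trans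
        (mul_le_mul_of_nonneg_left ?_ hinv)))
    have hX1 : (1 : ℝ) ≤ 2 * Fintype.card X := by exact_mod_cast (by omega)
    have hε := mul_le_mul_of_nonneg_left (le_mul_of_one_le_left
      (Real.sqrt_nonneg (2 * T * Real.log (N / δ))) hX1) N.cast_nonneg
    linarith
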